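/- Let $f\colon X\to\{0,1\}$ with $X\subseteq\{0,1\}^m$ be a possibly partial Boolean function. A randomized algorithm is a probability distribution over deterministic decision trees, each of which queries single bits of the input. For $\gamma\in(0,1]$, the worst-case randomized query complexity $\mathrm{R}_\gamma(P)$ of a function or relation $P$ is the minimum, over all randomized algorithms that output a correct answer with probability at least $\gamma$ on every input in the domain of $P$, of the maximum number of queries made by a decision tree in the support of the algorithm on an input in the domain of $P$. Write $\mathrm{R}(f)=\mathrm{R}_{2/3}(f)$. For $0\le k\le n$ and $y\in\{0,1\}^n$ let $$\mathrm{Label}^n_k(y)=\{z\in\{0,1,*\}^n : |\{i\in[n]: z_i\ne *\}|=k \text{ and, for all } i\in[n],\ z_i\neq *\Rightarrow z_i=y_i\},$$ and let $\mathrm{Label}^n_k\circ f$ be the problem of producing, on input $(x^{(1)},\dots,x^{(n)})\in X^n$, an element of $\mathrm{Label}^n_k(f(x^{(1)}),\dots,f(x^{(n)}))$. For $n\ge 1$ let $\mathrm{Choice}^n\circ f$ be the problem of producing, on the same inputs, a pair $(i,b)\in[n]\times\{0,1\}$ with $b=f(x^{(i)})$. **Labelled Threshold Direct Product Theorem.**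 There are universal constants $c\in(\tfrac12,1)$ and $C>0$ such that for every $m\in\mathbb{N}$, every (possibly partial) function $f\colon X\to\{0,1\}$ with $X\subseteq\{0,1\}^m$, every $n\in\mathbb{N}$, every $k\in\{0,\dots,n\}$ and every $\gamma\in[c,1)$, $$\mathrm{R}_{\gamma^k}\big(\mathrm{Label}^n_k\circ f\big)\ \ge\ C\,k\,\mathrm{R}(f).$$ In particular, for $k=1$, the choice problem satisfies $\mathrm{R}_{\gamma}\big(\mathrm{Choice}^n\circ f\big)\ge C\,\mathrm{R}(f)$ for every $n\ge1$ and $\gamma\in[c,1)$. -/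

import Mathlib

open scoped NNReal ENNReal

/-- A deterministic decision tree that queries bits of an input `x : ι → Bool` and outputs an
element of `O`.  At a node `query i t₀ t₁` it reads the bit `x i` and continues with `t₀` if the
bit is `0` (`false`) and with `t₁` if it is `1` (`true`). -/
inductive DecisionTree (ι O : Type) : Type
  | leaf (o : O) : DecisionTree ι O
  | query (i : ι) (t₀ t₁ : DecisionTree ι O) : DecisionTree ι O

namespace DecisionTree

variable {ι O : Type}

/-- The label of the leaf reached by the input `x`. -/
def output : DecisionTree ι O → (ι → Bool) → O
  | leaf o, _ => o
  | query i t₀ t₁, x => if x i then t₁.output x else t₀.output x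

/-- The depth of the leaf reached by the input `x`, that is, the number of queries made on `x`. -/
def cost : DecisionTree ι O → (ι → Bool) → ℕ
  | leaf _, _ => 0
  | query i t₀ t₁, x => (if x i then t₁.cost x else t₀.cost x) + 1

end DecisionTree

/-- A (possibly partial) computational problem on inputs in `{0,1}^ι`: the set of legal inputs
and, for every legal input, the set of correct outputs. -/
structure QueryProblem (ι O : Type) where
  dom : Set (ι → Bool)
  sol : dom → Set O

/-- The problem of computing a partial Boolean function `f : X → {0,1}`, `X ⊆ {0,1}^ι`. -/
def QueryProblem.ofFun {ι : Type} {X : Set (ι → Bool)} (f : X → Bool) : QueryProblem ι Bool where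
  dom := X
  sol x := {f x}

/-- The problem `S ∘ f^n`: on a legal input `(x⁽¹⁾, …, x⁽ⁿ⁾) ∈ X^n`, whose `j`-th bit of the `i`-th
block is indexed by `(i, j)`, the correct outputs are the elements of
`S (f(x⁽¹⁾), …, f(x⁽ⁿ⁾))`. -/
def QueryProblem.comp {ι O : Type} {n : ℕ} (S : (Fin n → Bool) → Set O)
    {X : Set (ι → Bool)} (f : X → Bool) : QueryProblem (Fin n × ι) O where
  dom := {x | ∀ i, (fun j => x (i, j)) ∈ X}
  sol x := S fun i => f ⟨fun j => x.1 (i, j), x.2 i⟩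

/-- A randomized algorithm: a probability distribution over deterministic decision trees. -/
abbrev RandomizedAlgorithm (ι O : Type) : Type := PMF (DecisionTree ι O)

namespace RandomizedAlgorithm

variable {ι O : Type}

/-- The probability that `R` outputs a correct answer on the legal input `x`. -/
noncomputable def successProb (R : RandomizedAlgorithm ι O) (P : QueryProblem ι O) (x : P.dom) :
    ℝ≥0∞ :=
  PMF.toOuterMeasure R {D | D.output x.1 ∈ P.sol x}

/-- `R` succeeds with probability at least `γ` on every legal input of `P`. -/
def Computes (R : RandomizedAlgorithm ι O) (P : QueryProblem ι O) (γ : ℝ) : Prop :=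
  ∀ x : P.dom, ENNReal.ofReal γ ≤ R.successProb P x

/-- The worst-case cost of `R`: the maximum number of queries over all legal inputs and all
decision trees in the support of `R`. -/
noncomputable def worstCost (R : RandomizedAlgorithm ι O) (P : QueryProblem ι O) : ℕ∞ :=
  ⨆ x : P.dom, ⨆ D ∈ PMF.support R, (D.cost x.1 : ℕ∞)

end RandomizedAlgorithm

/-- The worst-case randomized query complexity `R_γ(P)`: the least worst-case cost of a randomized
algorithm that succeeds with probability at least `γ` on every legal input
(`⊤` if there is no such algorithm). -/
noncomputable def randQueryComplexity {ι O : Type} (γ : ℝ) (P : QueryProblem ι O) : ℕ∞ :=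
  ⨅ R : {R : RandomizedAlgorithm ι O // R.Computes P γ}, R.1.worstCost P

/-- The `k`-of-`n` labelled threshold relation.  The symbol `*` is `none`. -/
def labelThreshold (n k : ℕ) (y : Fin n → Bool) : Set (Fin n → Option Bool) :=
  {z | (Finset.univ.filter fun i => z i ≠ none).card = k ∧ ∀ i, z i ≠ none → z i = some (y i)}

/-- The choice (one-of-`n`) relation: a pair `(i, b)` is correct if `b` is the `i`-th value. -/
def choiceRelation (n : ℕ) (y : Fin n → Bool) : Set (Fin n × Bool) :=
  {p | p.2 = y p.1}

/-!
Let `0 < ρ ≤ R(f)`, and let trees for `f` abstain if they wish: a right answer gains `1`, a wrong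
one loses `2`, and each query costs `3 / ρ`. Some distribution `μ` on inputs lets no tree gain
anything in expectation. Otherwise, by the minimax theorem, a randomized tree has positive expected
gain on every input, and restarting it until it answers computes `f` with fewer than `ρ` queries.

Now draw `n` independent inputs from `μ`. To each block assign the potential "mass plus half of the
gain that is still attainable from the bits read so far". A query splits the potential of its block
into two parts with sum at most `1 + 3 / (2 ρ)` times the potential, and at a leaf the inputs on
which a given label is right carry at most `2 / 3` of the potential, since answering with that
label is one of the available strategies. As the product of the potentials is at most `1` at the
start, a tree that makes `d` queries labels `k` blocks correctly with probability at most
`(2 / 3) ^ k * (1 + 3 / (2 ρ)) ^ d`, which is less than `(3 / 4) ^ k` when `d < k ρ / 20`.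
-/

section Minimax

variable {α κ : Type*} [Fintype α]

theorem exists_mem_forall_dotProduct_le {M K : Set (α → ℝ)} (hM_conv : Convex ℝ M)
    (hM_compact : IsCompact M) (hM : M.Nonempty) (hK : Convex ℝ K) {c : ℝ}
    (h : ∀ v ∈ K, ∃ μ ∈ M, μ ⬝ᵥ v ≤ c) : ∃ μ ∈ M, ∀ v ∈ K, μ ⬝ᵥ v ≤ c := by
  let value : (α → ℝ) → (α → ℝ) → EReal := fun μ v => ((μ ⬝ᵥ v : ℝ) : EReal)
  have hlsc (v : α → ℝ) : LowerSemicontinuousOn (fun μ => value μ v) M :=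
    (continuous_coe_real_ereal.comp
      (continuous_id.dotProduct continuous_const)).lowerSemicontinuous.lowerSemicontinuousOn M
  have husc (μ : α → ℝ) : UpperSemicontinuousOn (value μ) K :=
    (continuous_coe_real_ereal.comp
      (continuous_const.dotProduct continuous_id)).upperSemicontinuous.upperSemicontinuousOn K
  have hmono : Monotone Real.toEReal := EReal.coe_strictMono.monotone
  have hconv (v : α → ℝ) : QuasiconvexOn ℝ M fun μ => value μ v :=
    (((dotProductBilin ℝ ℝ).flip v).convexOn hM_conv).quasiconvexOn.monotone_comp
      (g := Real.toEReal) hmono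
  have hconc (μ : α → ℝ) : QuasiconcaveOn ℝ K (value μ) :=
    ((dotProductBilin ℝ ℝ μ).concaveOn hK).quasiconcaveOn.monotone_comp (g := Real.toEReal) hmono
  obtain ⟨μ, hμ, hmin⟩ := LowerSemicontinuousOn.exists_isMinOn
    (f := fun μ => ⨆ v ∈ K, value μ v) hM hM_compact (lowerSemicontinuousOn_biSup fun v _ => hlsc v)
  have hvalue : ⨆ v ∈ K, value μ v ≤ c := by
    calc ⨆ v ∈ K, value μ v ≤ ⨅ μ ∈ M, ⨆ v ∈ K, value μ v := le_iInf₂ hmin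
      _ = ⨆ v ∈ K, ⨅ μ ∈ M, value μ v :=
        Sion.minimax' hM hM_conv hM_compact (fun v _ => hlsc v) (fun v _ => hconv v) hK
          (fun μ _ => husc μ) fun μ _ => hconc μ
      _ ≤ c := iSup₂_le fun v hv => by
        obtain ⟨ν, hν, hνv⟩ := h v hv
        exact (iInf₂_le ν hν).trans (EReal.coe_le_coe_iff.2 hνv)
  exact ⟨μ, hμ, fun v hv => EReal.coe_le_coe_iff.1 ((iSup₂_le_iff.1 hvalue) v hv)⟩

theorem exists_mem_stdSimplex_forall_dotProduct_nonpos {K : Set (α → ℝ)} (hK : Convex ℝ K)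
    (hne : K.Nonempty) (h : ∀ v ∈ K, ∃ x, v x ≤ 0) :
    ∃ μ ∈ stdSimplex ℝ α, ∀ v ∈ K, μ ⬝ᵥ v ≤ 0 := by
  classical
  obtain ⟨v₀, hv₀⟩ := hne
  obtain ⟨x₀, -⟩ := h v₀ hv₀
  refine exists_mem_forall_dotProduct_le (convex_stdSimplex ℝ α) (isCompact_stdSimplex ℝ α)
    ⟨_, single_mem_stdSimplex ℝ x₀⟩ hK fun v hv => ?_
  obtain ⟨x, hx⟩ := h v hv
  exact ⟨Pi.single x 1, single_mem_stdSimplex ℝ x, by simpa using hx⟩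

theorem prod_mem_stdSimplex [Fintype κ] [DecidableEq κ] {p : κ → α → ℝ}
    (hp : ∀ i, p i ∈ stdSimplex ℝ α) :
    (fun s : κ → α => ∏ i, p i (s i)) ∈ stdSimplex ℝ (κ → α) :=
  ⟨fun s => Finset.prod_nonneg fun i _ => (hp i).1 (s i), by
    rw [← Fintype.prod_sum, Finset.prod_congr rfl fun i _ => (hp i).2, Finset.prod_const_one]⟩

end Minimax

theorem exists_mem_support_le_of_le_tsum {T : Type*} {R : PMF T} {g : T → ℝ≥0∞} {c : ℝ≥0∞}
    (hc : c ≠ ∞) (h : c ≤ ∑' D, R D * g D) : ∃ D ∈ R.support, c ≤ g D := by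
  by_contra! hlt
  obtain ⟨D₀, hD₀⟩ := R.support_nonempty
  have hconst : ∑' D, R D * c = c := by rw [ENNReal.tsum_mul_right, R.tsum_coe, one_mul]
  have hpointwise (D : T) : R D * g D ≤ R D * c := by
    by_cases hD : D ∈ R.support
    · gcongr
      exact (hlt D hD).le
    · simp [(R.apply_eq_zero_iff D).2 hD]
  have hfinite : ∑' D, R D * g D ≠ ∞ :=
    ne_top_of_le_ne_top hc ((ENNReal.tsum_le_tsum hpointwise).trans_eq hconst)
  have hstrict : ∑' D, R D * g D < ∑' D, R D * c :=
    ENNReal.tsum_lt_tsum hfinite hpointwise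
      (ENNReal.mul_lt_mul_right ((R.mem_support_iff D₀).1 hD₀) (R.apply_ne_top D₀) (hlt D₀ hD₀))
  exact (h.trans_lt hstrict).ne hconst.symm

theorem exists_mem_support_le_sum_of_forall_le {T Y : Type*} [Fintype Y] {R : PMF T}
    {W : Y → ℝ} (hW : W ∈ stdSimplex ℝ Y) {A : Y → T → Prop} [∀ y D, Decidable (A y D)] {γ : ℝ}
    (h : ∀ y, ENNReal.ofReal γ ≤ R.toOuterMeasure {D | A y D}) :
    ∃ D ∈ R.support, γ ≤ ∑ y with A y D, W y := by
  have hmean : ENNReal.ofReal γ ≤ ∑' D, R D * ∑ y with A y D, ENNReal.ofReal (W y) :=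
    calc ENNReal.ofReal γ = ∑ y, ENNReal.ofReal (W y) * ENNReal.ofReal γ := by
          rw [← Finset.sum_mul, ← ENNReal.ofReal_sum_of_nonneg fun y _ => hW.1 y, hW.2,
            ENNReal.ofReal_one, one_mul]
      _ ≤ ∑ y, ENNReal.ofReal (W y) * ∑' D, {D | A y D}.indicator R D := by
          gcongr with y
          exact (h y).trans_eq (R.toOuterMeasure_apply _)
      _ = ∑' D, R D * ∑ y with A y D, ENNReal.ofReal (W y) := by
          simp only [← ENNReal.tsum_mul_left, Finset.mul_sum, Finset.sum_filter]
          rw [← Summable.tsum_finsetSum fun _ _ => ENNReal.summable]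
          refine tsum_congr fun D => Finset.sum_congr rfl fun y _ => ?_
          simp [Set.indicator_apply, mul_comm]
  obtain ⟨D, hD, hle⟩ := exists_mem_support_le_of_le_tsum ENNReal.ofReal_ne_top hmean
  rw [← ENNReal.ofReal_sum_of_nonneg fun y _ => hW.1 y] at hle
  exact ⟨D, hD, (ENNReal.ofReal_le_ofReal_iff (Finset.sum_nonneg fun y _ => hW.1 y)).1 hle⟩

theorem randQueryComplexity_le_coe_iff {ι O : Type} {γ : ℝ} {P : QueryProblem ι O} {d : ℕ} :
    randQueryComplexity γ P ≤ d ↔ ∃ R : RandomizedAlgorithm ι O, R.Computes P γ ∧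
      ∀ x : P.dom, ∀ D ∈ R.support, D.cost x.1 ≤ d := by
  have hworst (R : RandomizedAlgorithm ι O) :
      R.worstCost P ≤ d ↔ ∀ x : P.dom, ∀ D ∈ R.support, D.cost x.1 ≤ d := by
    simp [RandomizedAlgorithm.worstCost]
  refine ⟨fun h => ?_, fun ⟨R, hR, hcost⟩ => iInf_le_of_le ⟨R, hR⟩ ((hworst R).2 hcost)⟩
  have hlt : randQueryComplexity γ P < (d + 1 : ℕ) :=
    h.trans_lt (by exact_mod_cast d.lt_succ_self)
  obtain ⟨R, hR⟩ := iInf_lt_iff.1 hlt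
  exact ⟨R.1, R.2, (hworst R.1).1 (ENat.lt_natCast_add_one_iff.1 (by exact_mod_cast hR))⟩

theorem randQueryComplexity_le_of_fintype {ι O : Type} {L : Type*} [Fintype L] {γ : ℝ}
    {P : QueryProblem ι O} {q : L → ℝ} (hq : q ∈ stdSimplex ℝ L) {K : L → DecisionTree ι O}
    {d : ℕ} (hcost : ∀ l, ∀ x : P.dom, (K l).cost x.1 ≤ d)
    [∀ x : P.dom, ∀ l, Decidable ((K l).output x.1 ∈ P.sol x)]
    (hsucc : ∀ x : P.dom, γ ≤ ∑ l with (K l).output x.1 ∈ P.sol x, q l) :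
    randQueryComplexity γ P ≤ d := by
  have hq_sum : ∑ l, ENNReal.ofReal (q l) = 1 := by
    rw [← ENNReal.ofReal_sum_of_nonneg fun l _ => hq.1 l, hq.2, ENNReal.ofReal_one]
  let R : RandomizedAlgorithm ι O := (PMF.ofFintype (fun l => ENNReal.ofReal (q l)) hq_sum).map K
  refine randQueryComplexity_le_coe_iff.2 ⟨R, fun x => ?_, fun x D hD => ?_⟩
  · have hprob : R.successProb P x =
        ENNReal.ofReal (∑ l with (K l).output x.1 ∈ P.sol x, q l) := by
      rw [RandomizedAlgorithm.successProb, PMF.toOuterMeasure_map_apply,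
        PMF.toOuterMeasure_ofFintype_apply, tsum_fintype,
        ENNReal.ofReal_sum_of_nonneg fun l _ => hq.1 l, Finset.sum_filter]
      simp [Set.indicator_apply]
    exact (ENNReal.ofReal_le_ofReal (hsucc x)).trans_eq hprob.symm
  · rw [PMF.support_map] at hD
    obtain ⟨l, -, rfl⟩ := hD
    exact hcost l x

namespace DecisionTree

variable {ι O : Type}

instance [Inhabited O] : Inhabited (DecisionTree ι O) := ⟨leaf default⟩

/-- Runs an abstaining tree, where the output `none` stands for abstention, with a budget of
queries. If it abstains, the run goes on with the continuation `K b`, where `b` is the unspent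
budget; when the budget is exhausted before a leaf is reached, the default answer is given. -/
def graft [Inhabited O] (K : ℕ → DecisionTree ι O) :
    DecisionTree ι (Option O) → ℕ → DecisionTree ι O
  | leaf none, b => K b
  | leaf (some o), _ => leaf o
  | query _ _ _, 0 => leaf default
  | query i t₀ t₁, b + 1 => query i (graft K t₀ b) (graft K t₁ b)

/-- Runs abstaining trees one after the other, under a common budget of queries, until one of them
answers. It turns an abstaining randomized tree, sampled afresh each time, into an algorithm of
bounded cost. -/
def restart [Inhabited O] : List (DecisionTree ι (Option O)) → ℕ → DecisionTree ι O
  | [], _ => default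
  | D :: Ds, b => graft (restart Ds) D b

theorem cost_graft_le [Inhabited O] {K : ℕ → DecisionTree ι O} {x : ι → Bool}
    (hK : ∀ b, (K b).cost x ≤ b) (D : DecisionTree ι (Option O)) (b : ℕ) :
    (graft K D b).cost x ≤ b := by
  induction D generalizing b with
  | leaf o => cases o <;> simp [graft, cost, hK]
  | query i t₀ t₁ ih₀ ih₁ =>
    cases b with
    | zero => simp [graft, cost]
    | succ b => cases hx : x i <;> simp [graft, cost, hx, ih₀, ih₁]

theorem cost_restart_le [Inhabited O] (Ds : List (DecisionTree ι (Option O))) (b : ℕ)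
    (x : ι → Bool) : (restart Ds b).cost x ≤ b := by
  induction Ds generalizing b with
  | nil => exact Nat.zero_le b
  | cons D Ds ih => exact cost_graft_le ih D b

theorem output_graft [Inhabited O] (K : ℕ → DecisionTree ι O) {x : ι → Bool}
    {D : DecisionTree ι (Option O)} {b : ℕ} (h : D.cost x ≤ b) :
    (graft K D b).output x = (D.output x).getD ((K (b - D.cost x)).output x) := by
  induction D generalizing b with
  | leaf o => cases o <;> simp [graft, cost, output]
  | query i t₀ t₁ ih₀ ih₁ =>
    cases b with
    | zero => simp [cost] at h
    | succ b =>
      rw [cost, Nat.add_le_add_iff_right] at h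
      cases hx : x i <;> simp only [hx, if_true, Bool.false_eq_true, if_false] at h <;>
        simp [graft, cost, output, hx, ih₀, ih₁, h]

end DecisionTree

section AbstainingGame

variable {ι B : Type} [DecidableEq B]

/-- The gain of an abstaining player who gives the answer `o` when the truth is `y`. A wrong answer
loses twice what a right one gains, so answering pays off only with confidence above `2 / 3`. -/
def reward : Option B → B → ℝ
  | none, _ => 0
  | some b, y => if b = y then 1 else -2

theorem reward_le_one (o : Option B) (y : B) : reward o y ≤ 1 := by
  cases o with
  | none => exact zero_le_one
  | some b => simp only [reward]; split_ifs <;> norm_num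

/-- The reward of an abstaining tree on an input `x` with value `y`, minus a fee `a` per query. -/
def score (a : ℝ) (D : DecisionTree ι (Option B)) (x : ι → Bool) (y : B) : ℝ :=
  reward (D.output x) y - a * D.cost x

theorem score_le_one {a : ℝ} (ha : 0 ≤ a) (D : DecisionTree ι (Option B)) (x : ι → Bool) (y : B) :
    score a D x y ≤ 1 :=
  (sub_le_self _ (mul_nonneg ha (Nat.cast_nonneg _))).trans (reward_le_one _ _)

variable {L J : Type*} [Fintype L] [Fintype J] [Inhabited B]

/-- Each query already made counts as a loss of `1 / ρ` of success probability. A right answer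
succeeds with probability `1 ≥ t + 1 / 3`, and a wrong one forfeits at most `t ≤ 2 / 3`: these are
the rewards `1` and `-2`, divided by `3`. -/
theorem le_sum_output_graft_eq {q : L → ℝ} (hq : q ∈ stdSimplex ℝ L)
    {K : L → ℕ → DecisionTree ι B} {x : ι → Bool} {y : B} {ρ : ℕ} {t : ℝ} (ht : t ≤ 2 / 3)
    (hK : ∀ b < ρ, ((b : ℝ) + 1) / ρ - 1 + t ≤ ∑ l with (K l b).output x = y, q l)
    (D : DecisionTree ι (Option B)) {b : ℕ} (hb : b < ρ) :
    ((b : ℝ) + 1) / ρ - 1 + t + score (3 / ρ) D x y / 3 ≤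
      ∑ l with (DecisionTree.graft (K l) D b).output x = y, q l := by
  have hρ : (0 : ℝ) < ρ := by exact_mod_cast hb.pos
  have hfee : 3 / (ρ : ℝ) * D.cost x = 3 * (D.cost x / ρ) := by ring
  rcases le_or_gt (D.cost x) b with hcost | hcost
  · have hbudget : ((b : ℝ) + 1) / ρ ≤ 1 := (div_le_one hρ).2 (by exact_mod_cast hb)
    have hspent : 0 ≤ (D.cost x : ℝ) / ρ := by positivity
    simp only [DecisionTree.output_graft _ hcost, score, hfee]
    match D.output x with
    | none =>
      have hrest := hK (b - D.cost x) ((Nat.sub_le _ _).trans_lt hb)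
      rw [Nat.cast_sub hcost] at hrest
      have hsplit : ((b : ℝ) - D.cost x + 1) / ρ = (b + 1) / ρ - D.cost x / ρ := by ring
      simp only [Option.getD_none, reward]
      linarith
    | some o =>
      by_cases hoy : o = y
      · simp only [reward, hoy, ↓reduceIte, Option.getD_some, Finset.filter_true, hq.2]
        linarith
      · simp only [reward, hoy, ↓reduceIte, Option.getD_some, Finset.filter_false, Finset.sum_empty]
        linarith
  · have hover : ((b : ℝ) + 1) / ρ ≤ D.cost x / ρ := by
      gcongr
      exact_mod_cast hcost
    have hreward := reward_le_one (D.output x) y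
    refine le_trans ?_ (Finset.sum_nonneg fun l _ => hq.1 l)
    rw [score, hfee]
    linarith

theorem le_sum_output_restart_eq {p : J → ℝ} (hp : p ∈ stdSimplex ℝ J)
    {D : J → DecisionTree ι (Option B)} {x : ι → Bool} {y : B} {ρ N : ℕ}
    (hscore : 2 / (N : ℝ) ≤ ∑ j, p j * score (3 / ρ) (D j) x y) {r : ℕ} (hr : r ≤ N) {b : ℕ}
    (hb : b < ρ) :
    ((b : ℝ) + 1) / ρ - 1 + 2 / 3 * (r / N) ≤
      ∑ s : Fin r → J with (DecisionTree.restart (List.ofFn fun i => D (s i)) b).output x = y,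
        ∏ i, p (s i) := by
  induction r generalizing b with
  | zero =>
    have hρ : (0 : ℝ) < ρ := by exact_mod_cast hb.pos
    have hbudget : ((b : ℝ) + 1) / ρ ≤ 1 := (div_le_one hρ).2 (by exact_mod_cast hb)
    refine le_trans ?_ (Finset.sum_nonneg fun s _ => Finset.prod_nonneg fun i _ => hp.1 (s i))
    simp only [Nat.cast_zero, zero_div, mul_zero]
    linarith
  | succ r ih =>
    have hN : (0 : ℝ) < N := by exact_mod_cast hr.trans_lt' r.succ_pos
    have ht : 2 / 3 * ((r : ℝ) / N) ≤ 2 / 3 :=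
      mul_le_of_le_one_right (by norm_num)
        ((div_le_one hN).2 (by exact_mod_cast r.le_succ.trans hr))
    have hstep (j : J) := le_sum_output_graft_eq (prod_mem_stdSimplex fun _ : Fin r => hp) ht
      (fun b hb => ih (r.le_succ.trans hr) hb) (D j) hb
    calc ((b : ℝ) + 1) / ρ - 1 + 2 / 3 * ((r + 1 : ℕ) / N)
        = (((b : ℝ) + 1) / ρ - 1 + 2 / 3 * (r / N)) + 2 / N / 3 := by push_cast; ring
      _ ≤ (((b : ℝ) + 1) / ρ - 1 + 2 / 3 * (r / N)) +
          (∑ j, p j * score (3 / ρ) (D j) x y) / 3 := by gcongr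
      _ = ∑ j, p j * (((b : ℝ) + 1) / ρ - 1 + 2 / 3 * (r / N) + score (3 / ρ) (D j) x y / 3) := by
        simp only [mul_add, Finset.sum_add_distrib, ← Finset.sum_mul, hp.2, one_mul,
          Finset.sum_div, mul_div_assoc]
      _ ≤ ∑ j, p j * ∑ s : Fin r → J with (DecisionTree.graft (DecisionTree.restart
          (List.ofFn fun i => D (s i))) (D j) b).output x = y, ∏ i, p (s i) := by
        gcongr with j
        · exact hp.1 j
        · exact hstep j
      _ = _ := by
        rw [Finset.sum_filter, ← (Fin.consEquiv fun _ => J).sum_comp, Fintype.sum_prod_type]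
        simp only [Fin.consEquiv_apply, Fin.prod_univ_succ, Fin.cons_zero,
          Fin.cons_succ, Finset.mul_sum, Finset.sum_filter, List.ofFn_succ, DecisionTree.restart,
          mul_ite, mul_zero]

end AbstainingGame

section HardDistribution

variable {ι : Type} {X : Set (ι → Bool)}

theorem randQueryComplexity_lt_of_score_pos [Finite X] (f : X → Bool) {J : Type*} [Fintype J]
    {p : J → ℝ} (hp : p ∈ stdSimplex ℝ J) (D : J → DecisionTree ι (Option Bool)) {ρ : ℕ}
    (hρ : 0 < ρ) (hpos : ∀ x : X, 0 < ∑ j, p j * score (3 / ρ) (D j) x.1 (f x)) :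
    randQueryComplexity (2 / 3) (QueryProblem.ofFun f) < ρ := by
  obtain ⟨N, hN_score, hN⟩ : ∃ N : ℕ,
      (∀ x : X, 2 / (N : ℝ) ≤ ∑ j, p j * score (3 / ρ) (D j) x.1 (f x)) ∧ 0 < N :=
    ((Filter.eventually_all.2 fun x =>
      ((tendsto_const_div_atTop_nhds_zero_nat 2).eventually_le_const (hpos x))).and
      (Filter.eventually_gt_atTop 0)).exists
  have hle : randQueryComplexity (2 / 3) (QueryProblem.ofFun f) ≤ (ρ - 1 : ℕ) := by
    classical
    refine randQueryComplexity_le_of_fintype (prod_mem_stdSimplex fun _ : Fin N => hp)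
      (K := fun s => DecisionTree.restart (List.ofFn fun i => D (s i)) (ρ - 1))
      (fun s x => DecisionTree.cost_restart_le _ _ _) fun x => ?_
    have hsucc := le_sum_output_restart_eq hp (hN_score x) le_rfl (Nat.sub_lt hρ one_pos)
    have hρ' : (ρ : ℝ) ≠ 0 := by exact_mod_cast hρ.ne'
    have hN' : (N : ℝ) ≠ 0 := by exact_mod_cast hN.ne'
    rw [Nat.cast_pred hρ, sub_add_cancel, div_self hρ', div_self hN', sub_self,
      zero_add, mul_one] at hsucc
    simpa [QueryProblem.ofFun] using hsucc
  exact hle.trans_lt (by exact_mod_cast Nat.sub_lt hρ one_pos)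

theorem exists_hard_distribution [Fintype X] (f : X → Bool) {ρ : ℕ} (hρ : 0 < ρ)
    (hle : (ρ : ℕ∞) ≤ randQueryComplexity (2 / 3) (QueryProblem.ofFun f)) :
    ∃ μ ∈ stdSimplex ℝ X, ∀ D : DecisionTree ι (Option Bool),
      ∑ x : X, μ x * score (3 / ρ) D x.1 (f x) ≤ 0 := by
  let payoff : DecisionTree ι (Option Bool) → X → ℝ := fun D x => score (3 / ρ) D x.1 (f x)
  have hplayer : ∀ v ∈ convexHull ℝ (Set.range payoff), ∃ x, v x ≤ 0 := by
    intro v hv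
    by_contra! hpos
    obtain ⟨J, _, p, z, hp_nonneg, hp_sum, hz, rfl⟩ := mem_convexHull_iff_exists_fintype.1 hv
    choose D hD using hz
    refine (randQueryComplexity_lt_of_score_pos f ⟨hp_nonneg, hp_sum⟩ D hρ fun x => ?_).not_ge hle
    simpa [← hD, payoff] using hpos x
  obtain ⟨μ, hμ, hle⟩ := exists_mem_stdSimplex_forall_dotProduct_nonpos
    (convex_convexHull ℝ _) ((Set.range_nonempty payoff).convexHull) hplayer
  exact ⟨μ, hμ, fun D => hle _ (subset_convexHull ℝ _ ⟨D, rfl⟩)⟩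

end HardDistribution

section Potential

variable {ι B : Type} {X : Set (ι → Bool)} {w : X → ℝ} {a : ℝ}

/-- The weights `w` restricted to the inputs whose `j`-th bit is `b`. They are not renormalized, so
that the two restrictions add up to `w`. -/
noncomputable def restrictBit (w : X → ℝ) (j : ι) (b : Bool) : X → ℝ :=
  {x : X | x.1 j = b}.indicator w

theorem restrictBit_nonneg (hw : 0 ≤ w) (j : ι) (b : Bool) : 0 ≤ restrictBit w j b :=
  fun x => Set.indicator_nonneg (fun x _ => hw x) x

theorem restrictBit_false_add_true (w : X → ℝ) (j : ι) :
    restrictBit w j false + restrictBit w j true = w := by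
  have hcompl : {x : X | x.1 j = true} = {x : X | x.1 j = false}ᶜ := by
    ext x
    simp
  rw [restrictBit, restrictBit, hcompl, Set.indicator_self_add_compl]

variable [DecidableEq B] [Fintype X]

theorem sum_restrictBit_mul_score_add (a : ℝ) (f : X → B) (w : X → ℝ) (j : ι)
    (t₀ t₁ : DecisionTree ι (Option B)) :
    ∑ x, restrictBit w j false x * score a t₀ x.1 (f x) +
        ∑ x, restrictBit w j true x * score a t₁ x.1 (f x) =
      ∑ x, w x * score a (.query j t₀ t₁) x.1 (f x) + a * ∑ x, w x := by
  rw [← Finset.sum_add_distrib, Finset.mul_sum, ← Finset.sum_add_distrib]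
  refine Finset.sum_congr rfl fun x _ => ?_
  cases hx : x.1 j <;>
    simp [restrictBit, score, DecisionTree.output, DecisionTree.cost, hx] <;> ring

/-- The supremum of the total scores of abstaining trees for `f` on inputs weighted by `w`. When
`a` and `w` are nonnegative it is finite, by `bddAbove_range_sum_mul_score`. -/
noncomputable def bestScore (a : ℝ) (f : X → B) (w : X → ℝ) : ℝ :=
  ⨆ D : DecisionTree ι (Option B), ∑ x, w x * score a D x.1 (f x)

theorem bddAbove_range_sum_mul_score (ha : 0 ≤ a) (f : X → B) (hw : 0 ≤ w) :
    BddAbove (Set.range fun D : DecisionTree ι (Option B) => ∑ x, w x * score a D x.1 (f x)) :=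
  ⟨∑ x, w x, Set.forall_mem_range.2 fun D =>
    Finset.sum_le_sum fun x _ => mul_le_of_le_one_right (hw x) (score_le_one ha D x.1 (f x))⟩

theorem sum_mul_score_le_bestScore (ha : 0 ≤ a) (f : X → B) (hw : 0 ≤ w)
    (D : DecisionTree ι (Option B)) : ∑ x, w x * score a D x.1 (f x) ≤ bestScore a f w :=
  le_ciSup (bddAbove_range_sum_mul_score ha f hw) D

theorem bestScore_nonneg (ha : 0 ≤ a) (f : X → B) (hw : 0 ≤ w) : 0 ≤ bestScore a f w := by
  simpa [score, reward, DecisionTree.output, DecisionTree.cost] using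
    sum_mul_score_le_bestScore ha f hw (.leaf none)

theorem bestScore_restrictBit_add_le (ha : 0 ≤ a) (f : X → B) (hw : 0 ≤ w) (j : ι) :
    bestScore a f (restrictBit w j false) + bestScore a f (restrictBit w j true) ≤
      bestScore a f w + a * ∑ x, w x :=
  ciSup_add_ciSup_le fun t₀ t₁ => by
    rw [sum_restrictBit_mul_score_add]
    gcongr
    exact sum_mul_score_le_bestScore ha f hw _

/-- The potential of a block whose inputs have weights `w`: their mass plus half of the score that
can still be attained. It controls both what one more query and what an answer can achieve. -/
noncomputable def potential (a : ℝ) (f : X → B) (w : X → ℝ) : ℝ :=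
  ∑ x, w x + bestScore a f w / 2

theorem sum_le_potential (ha : 0 ≤ a) (f : X → B) (hw : 0 ≤ w) : ∑ x, w x ≤ potential a f w :=
  le_add_of_nonneg_right (div_nonneg (bestScore_nonneg ha f hw) two_pos.le)

theorem potential_nonneg (ha : 0 ≤ a) (f : X → B) (hw : 0 ≤ w) : 0 ≤ potential a f w :=
  (Finset.sum_nonneg fun x _ => hw x).trans (sum_le_potential ha f hw)

theorem sum_filter_eq_le_potential (ha : 0 ≤ a) (f : X → B) (hw : 0 ≤ w) (b : B) :
    ∑ x with f x = b, w x ≤ 2 / 3 * potential a f w := by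
  have hanswer : ∑ x, w x * score a (.leaf (some b)) x.1 (f x) =
      3 * ∑ x with f x = b, w x - 2 * ∑ x, w x := by
    simp only [Finset.sum_filter, Finset.mul_sum, ← Finset.sum_sub_distrib]
    refine Finset.sum_congr rfl fun x _ => ?_
    by_cases hx : f x = b <;>
      simp [score, reward, DecisionTree.output, DecisionTree.cost, eq_comm (a := b), hx] <;> ring
  have hbest := sum_mul_score_le_bestScore ha f hw (.leaf (some b))
  rw [hanswer] at hbest
  rw [potential]
  linarith

theorem potential_restrictBit_add_le (ha : 0 ≤ a) (f : X → B) (hw : 0 ≤ w) (j : ι) :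
    potential a f (restrictBit w j false) + potential a f (restrictBit w j true) ≤
      (1 + a / 2) * potential a f w := by
  have hmass : ∑ x, restrictBit w j false x + ∑ x, restrictBit w j true x = ∑ x, w x := by
    conv_rhs => rw [← restrictBit_false_add_true w j]
    exact Finset.sum_add_distrib.symm
  have hscore := bestScore_restrictBit_add_le ha f hw j
  have hfee := mul_nonneg ha (bestScore_nonneg ha f hw)
  simp only [potential]
  linarith

end Potential

section Blocks

variable {ι O B κ : Type} {X : Set (ι → Bool)}

/-- The input of the composed problem whose blocks are the inputs `y i` of `f`. -/
def joinBlocks (y : κ → X) : κ × ι → Bool :=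
  fun q => (y q.1).1 q.2

/-- The relation `S` labels `k` blocks: an answer that is correct for `v` determines `k` coordinates
of `v`. -/
def Labels (S : (κ → B) → Set O) (k : ℕ) : Prop :=
  ∀ v, ∀ o ∈ S v, ∃ s : Finset κ, s.card = k ∧ ∀ v', o ∈ S v' → ∀ i ∈ s, v' i = v i

theorem labels_choiceRelation (n : ℕ) : Labels (choiceRelation n) 1 :=
  fun _ o ho => ⟨{o.1}, rfl, fun _ ho' i hi => by
    rw [Finset.mem_singleton.1 hi]
    exact Eq.trans (Eq.symm ho') ho⟩

theorem labels_labelThreshold (n k : ℕ) : Labels (labelThreshold n k) k :=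
  fun _ o ho => ⟨_, ho.1, fun _ ho' i hi =>
    have hi : o i ≠ none := (Finset.mem_filter.1 hi).2
    Option.some_injective _ ((ho'.2 i hi).symm.trans (ho.2 i hi))⟩

variable [Fintype κ] [DecidableEq κ]

theorem prod_update_restrictBit (w : κ → X → ℝ) (i : κ) (j : ι) (b : Bool) (y : κ → X) :
    ∏ l, Function.update w i (restrictBit (w i) j b) l (y l) =
      if (y i).1 j = b then ∏ l, w l (y l) else 0 := by
  rw [← Finset.mul_prod_erase _ _ (Finset.mem_univ i),
    ← Finset.mul_prod_erase _ (fun l => w l (y l)) (Finset.mem_univ i), Function.update_self,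
    restrictBit, Set.indicator_apply, Finset.prod_congr rfl fun l hl => by
      rw [Function.update_of_ne (Finset.ne_of_mem_erase hl)]]
  exact ite_zero_mul _ _ _

variable [Fintype X]

open scoped Classical in
/-- The mass, under the product of the weights `w`, of the inputs on which `D` solves `S ∘ f`,
discounted for each query by `1 + a / 2`, the factor by which a query may increase the total
`potential`. -/
noncomputable def discountedSuccess (a : ℝ) (f : X → B) (S : (κ → B) → Set O)
    (w : κ → X → ℝ) (D : DecisionTree (κ × ι) O) : ℝ :=
  ∑ y : κ → X with D.output (joinBlocks y) ∈ S fun i => f (y i),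
    (∏ i, w i (y i)) / (1 + a / 2) ^ D.cost (joinBlocks y)

theorem discountedSuccess_query (a : ℝ) (f : X → B) (S : (κ → B) → Set O) (w : κ → X → ℝ)
    (i : κ) (j : ι) (t₀ t₁ : DecisionTree (κ × ι) O) :
    discountedSuccess a f S w (.query (i, j) t₀ t₁) =
      (discountedSuccess a f S (Function.update w i (restrictBit (w i) j false)) t₀ +
        discountedSuccess a f S (Function.update w i (restrictBit (w i) j true)) t₁) /
          (1 + a / 2) := by
  simp only [discountedSuccess, Finset.sum_filter, ← Finset.sum_add_distrib, Finset.sum_div,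
    prod_update_restrictBit]
  refine Finset.sum_congr rfl fun y _ => ?_
  have houtput : (DecisionTree.query (i, j) t₀ t₁).output (joinBlocks y) =
      if (y i).1 j then t₁.output (joinBlocks y) else t₀.output (joinBlocks y) := rfl
  have hcost : (DecisionTree.query (i, j) t₀ t₁).cost (joinBlocks y) =
      (if (y i).1 j then t₁.cost (joinBlocks y) else t₀.cost (joinBlocks y)) + 1 := rfl
  rw [houtput, hcost]
  cases hy : (y i).1 j <;> simp [pow_succ, ite_div, div_div]

variable [DecidableEq B] {S : (κ → B) → Set O} {k : ℕ} {a : ℝ} {w : κ → X → ℝ}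

theorem discountedSuccess_leaf_le (hS : Labels S k) (ha : 0 ≤ a) (f : X → B)
    (hw : ∀ i, 0 ≤ w i) (o : O) :
    discountedSuccess a f S w (.leaf o) ≤ (2 / 3) ^ k * ∏ i, potential a f (w i) := by
  classical
  have hleaf : discountedSuccess a f S w (.leaf o) =
      ∑ y : κ → X with o ∈ S fun i => f (y i), ∏ i, w i (y i) := by
    simp only [discountedSuccess, DecisionTree.cost, pow_zero, div_one]
    rfl
  rw [hleaf]
  have hpot (i : κ) := potential_nonneg ha f (hw i)
  rcases Finset.eq_empty_or_nonempty {y : κ → X | o ∈ S fun i => f (y i)} with hempty | ⟨y₀, hy₀⟩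
  · rw [hempty, Finset.sum_empty]
    exact mul_nonneg (by positivity) (Finset.prod_nonneg fun i _ => hpot i)
  obtain ⟨s, hs_card, hs⟩ := hS _ o (Finset.mem_filter.1 hy₀).2
  calc ∑ y : κ → X with o ∈ S fun i => f (y i), ∏ i, w i (y i)
      ≤ ∑ y ∈ Fintype.piFinset fun i => {x | i ∈ s → f x = f (y₀ i)}, ∏ i, w i (y i) := by
        refine Finset.sum_le_sum_of_subset_of_nonneg (fun y hy => ?_) fun y _ _ =>
          Finset.prod_nonneg fun i _ => hw i (y i)
        simpa [Fintype.mem_piFinset] using hs _ (Finset.mem_filter.1 hy).2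
    _ = ∏ i, ∑ x with i ∈ s → f x = f (y₀ i), w i x := (Finset.prod_univ_sum _ _).symm
    _ ≤ ∏ i, (if i ∈ s then 2 / 3 else 1) * potential a f (w i) := by
        refine Finset.prod_le_prod (fun i _ => Finset.sum_nonneg fun x _ => hw i x) fun i _ => ?_
        by_cases hi : i ∈ s
        · simpa [hi] using sum_filter_eq_le_potential ha f (hw i) (f (y₀ i))
        · simpa [hi] using sum_le_potential ha f (hw i)
    _ = (2 / 3) ^ k * ∏ i, potential a f (w i) := by
        rw [Finset.prod_mul_distrib, Finset.prod_ite_mem, Finset.univ_inter, Finset.prod_const,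
          hs_card]

theorem discountedSuccess_le (hS : Labels S k) (ha : 0 ≤ a) (f : X → B) (hw : ∀ i, 0 ≤ w i)
    (D : DecisionTree (κ × ι) O) :
    discountedSuccess a f S w D ≤ (2 / 3) ^ k * ∏ i, potential a f (w i) := by
  induction D generalizing w with
  | leaf o => exact discountedSuccess_leaf_le hS ha f hw o
  | query q t₀ t₁ ih₀ ih₁ =>
    obtain ⟨i, j⟩ := q
    have hprod (b : Bool) :
        ∏ l, potential a f (Function.update w i (restrictBit (w i) j b) l) =
          potential a f (restrictBit (w i) j b) * ∏ l ∈ Finset.univ \ {i}, potential a f (w l) := by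
      rw [← Finset.prod_update_of_mem (Finset.mem_univ i)]
      exact Finset.prod_congr rfl fun l _ => Function.apply_update (fun _ => potential a f) _ _ _ _
    have hw' (b : Bool) (l : κ) : 0 ≤ Function.update w i (restrictBit (w i) j b) l := by
      rcases eq_or_ne l i with rfl | hl
      · simpa using restrictBit_nonneg (hw l) j b
      · simpa [hl] using hw l
    have hrest : 0 ≤ ∏ l ∈ Finset.univ \ {i}, potential a f (w l) :=
      Finset.prod_nonneg fun l _ => potential_nonneg ha f (hw l)
    rw [discountedSuccess_query, div_le_iff₀ (by positivity)]
    calc _ ≤ (2 / 3) ^ k * _ + (2 / 3) ^ k * _ :=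
          add_le_add (ih₀ (hw' false)) (ih₁ (hw' true))
      _ = (2 / 3) ^ k * ((potential a f (restrictBit (w i) j false) +
            potential a f (restrictBit (w i) j true)) *
              ∏ l ∈ Finset.univ \ {i}, potential a f (w l)) := by
          rw [hprod, hprod]
          ring
      _ ≤ (2 / 3) ^ k * ((1 + a / 2) * potential a f (w i) *
              ∏ l ∈ Finset.univ \ {i}, potential a f (w l)) := by
          gcongr
          exact potential_restrictBit_add_le ha f (hw i) j
      _ = (2 / 3) ^ k * (∏ l, potential a f (w l)) * (1 + a / 2) := by
          rw [Finset.prod_eq_mul_prod_sdiff_singleton_of_mem (Finset.mem_univ i)]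
          ring

end Blocks

section LowerBound

variable {ι O : Type} {n k : ℕ} {S : (Fin n → Bool) → Set O} {X : Set (ι → Bool)}

theorem le_pow_mul_pow_of_computes [Fintype X] (hS : Labels S k) {a : ℝ} (ha : 0 ≤ a)
    {f : X → Bool} {μ : X → ℝ} (hμ : μ ∈ stdSimplex ℝ X)
    (hhard : ∀ D : DecisionTree ι (Option Bool), ∑ x : X, μ x * score a D x.1 (f x) ≤ 0)
    {R : RandomizedAlgorithm (Fin n × ι) O} {γ : ℝ} (hR : R.Computes (QueryProblem.comp S f) γ)
    {d : ℕ} (hcost : ∀ x : (QueryProblem.comp S f).dom, ∀ D ∈ R.support, D.cost x.1 ≤ d) :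
    γ ≤ (2 / 3) ^ k * (1 + a / 2) ^ d := by
  classical
  have hbest : bestScore a f μ ≤ 0 := ciSup_le hhard
  have hpotential : potential a f μ ≤ 1 := by
    rw [potential, hμ.2]
    linarith
  let input (y : Fin n → X) : (QueryProblem.comp S f).dom := ⟨joinBlocks y, fun i => (y i).2⟩
  obtain ⟨D, hD, hγ⟩ := exists_mem_support_le_sum_of_forall_le
    (prod_mem_stdSimplex fun _ : Fin n => hμ)
    (A := fun y (D : DecisionTree _ _) => D.output (joinBlocks y) ∈ S fun i => f (y i))
    fun y => hR (input y)
  calc γ ≤ ∑ y : Fin n → X with D.output (joinBlocks y) ∈ S fun i => f (y i), ∏ i, μ (y i) := hγ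
    _ ≤ discountedSuccess a f S (fun _ => μ) D * (1 + a / 2) ^ d := by
      rw [discountedSuccess, Finset.sum_mul]
      refine Finset.sum_le_sum fun y _ => ?_
      rw [div_mul_eq_mul_div, le_div_iff₀ (by positivity)]
      gcongr
      · exact Finset.prod_nonneg fun i _ => hμ.1 (y i)
      · linarith
      · exact hcost (input y) D hD
    _ ≤ (2 / 3) ^ k * (∏ _i : Fin n, potential a f μ) * (1 + a / 2) ^ d := by
      gcongr
      exact discountedSuccess_le hS ha f (fun _ => hμ.1) D
    _ ≤ (2 / 3) ^ k * (1 + a / 2) ^ d := by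
      gcongr
      exact mul_le_of_le_one_right (by positivity)
        (Finset.prod_le_one (fun _ _ => potential_nonneg ha f hμ.1) fun _ _ => hpotential)

/-- With `d < k * ρ / 20` the second factor is at most `exp (3 / 40) ^ k`, and `exp (3 / 40)` is
less than `9 / 8 = (3 / 4) / (2 / 3)`. -/
theorem two_thirds_pow_mul_pow_lt {k ρ d : ℕ} (h : 20 * d < k * ρ) :
    (2 / 3 : ℝ) ^ k * (1 + 3 / (ρ : ℝ) / 2) ^ d < (3 / 4) ^ k := by
  have hk : k ≠ 0 := by
    rintro rfl
    simp at h
  have hρ : (0 : ℝ) < ρ := by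
    rcases ρ.eq_zero_or_pos with rfl | hρ
    · simp at h
    · exact_mod_cast hρ
  have hexponent : d * (3 / (ρ : ℝ) / 2) ≤ k * (3 / 40) := by
    have hreal : 20 * (d : ℝ) ≤ k * ρ := by exact_mod_cast h.le
    calc d * (3 / (ρ : ℝ) / 2) = 20 * d / ρ * (3 / 40) := by ring
      _ ≤ k * (3 / 40) := by
        gcongr
        exact (div_le_iff₀ hρ).2 hreal
  have hexp : Real.exp (3 / 40) < 9 / 8 := by
    rw [← Real.lt_log_iff_exp_lt (by norm_num)]
    exact lt_of_lt_of_le (by norm_num) (Real.one_sub_inv_le_log_of_pos (by norm_num))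
  calc (2 / 3 : ℝ) ^ k * (1 + 3 / (ρ : ℝ) / 2) ^ d
      ≤ (2 / 3) ^ k * Real.exp (3 / ρ / 2) ^ d := by
        gcongr
        rw [add_comm]
        exact Real.add_one_le_exp _
    _ = (2 / 3) ^ k * Real.exp (d * (3 / ρ / 2)) := by rw [Real.exp_nat_mul]
    _ ≤ (2 / 3) ^ k * Real.exp (k * (3 / 40)) := by gcongr
    _ = (2 / 3 * Real.exp (3 / 40)) ^ k := by rw [Real.exp_nat_mul, mul_pow]
    _ < (3 / 4) ^ k := by
      gcongr
      linarith

theorem mul_le_mul_of_randQueryComplexity_comp_le [Finite X] (hS : Labels S k) {f : X → Bool}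
    {γ : ℝ} (hγ : 3 / 4 ≤ γ) {ρ d : ℕ}
    (hρ : (ρ : ℕ∞) ≤ randQueryComplexity (2 / 3) (QueryProblem.ofFun f))
    (hd : randQueryComplexity (γ ^ k) (QueryProblem.comp S f) ≤ d) : k * ρ ≤ 20 * d := by
  by_contra! hlt
  have := Fintype.ofFinite X
  have hρ_pos : 0 < ρ := Nat.pos_of_mul_pos_left (Nat.zero_lt_of_lt hlt)
  obtain ⟨μ, hμ, hhard⟩ := exists_hard_distribution f hρ_pos hρ
  obtain ⟨R, hR, hcost⟩ := randQueryComplexity_le_coe_iff.1 hd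
  have hsucc := le_pow_mul_pow_of_computes hS (by positivity) hμ hhard hR hcost
  refine (hsucc.trans_lt (two_thirds_pow_mul_pow_lt hlt)).not_ge ?_
  gcongr

theorem mul_le_mul_randQueryComplexity_comp [Finite X] (hS : Labels S k) (f : X → Bool) {γ : ℝ}
    (hγ : 3 / 4 ≤ γ) :
    (k : ℕ∞) * randQueryComplexity (2 / 3) (QueryProblem.ofFun f) ≤
      20 * randQueryComplexity (γ ^ k) (QueryProblem.comp S f) := by
  have hbound (ρ d : ℕ) :=
    mul_le_mul_of_randQueryComplexity_comp_le hS (f := f) hγ (ρ := ρ) (d := d)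
  generalize randQueryComplexity (2 / 3) (QueryProblem.ofFun f) = P at *
  generalize randQueryComplexity (γ ^ k) (QueryProblem.comp S f) = Q at *
  cases Q with
  | top => simp
  | coe d =>
    cases P with
    | coe ρ => exact_mod_cast hbound ρ d le_rfl le_rfl
    | top =>
      have hk : k * (20 * d + 1) ≤ 20 * d := hbound (20 * d + 1) d le_top le_rfl
      have hk_zero : k = 0 := by
        by_contra hk_ne
        nlinarith [Nat.pos_of_ne_zero hk_ne]
      simp [hk_zero]

theorem mainTheorem7_general [Finite X] (hS : Labels S k) (f : X → Bool) {γ : ℝ}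
    (hγ : 3 / 4 ≤ γ) :
    ((1 / 20 : ℝ≥0) : ℝ≥0∞) * k * (randQueryComplexity (2 / 3) (QueryProblem.ofFun f) : ℝ≥0∞) ≤
      (randQueryComplexity (γ ^ k) (QueryProblem.comp S f) : ℝ≥0∞) := by
  have h := ENat.toENNReal_le.2 (mul_le_mul_randQueryComplexity_comp hS f hγ)
  rw [ENat.toENNReal_mul, ENat.toENNReal_mul] at h
  have hconst : ((1 / 20 : ℝ≥0) : ℝ≥0∞) = 20⁻¹ := by
    rw [one_div, ENNReal.coe_inv (by norm_num), ENNReal.coe_ofNat]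
  rw [hconst, mul_assoc, ENNReal.inv_mul_le_iff (by norm_num) (by norm_num)]
  simpa using h

end LowerBound

theorem mainTheorem7 :
    ∃ c : ℝ, 1 / 2 < c ∧ c < 1 ∧ ∃ C : ℝ≥0, 0 < C ∧
      ∀ (m : ℕ) (X : Set (Fin m → Bool)) (f : X → Bool) (n : ℕ) (γ : ℝ), c ≤ γ → γ < 1 →
        (∀ k : ℕ, k ≤ n →
          (C : ℝ≥0∞) * (k : ℝ≥0∞) *
              (randQueryComplexity (2 / 3) (QueryProblem.ofFun f) : ℝ≥0∞) ≤
            (randQueryComplexity (γ ^ k) (QueryProblem.comp (labelThreshold n k) f) : ℝ≥0∞)) ∧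
        (1 ≤ n →
          (C : ℝ≥0∞) * (randQueryComplexity (2 / 3) (QueryProblem.ofFun f) : ℝ≥0∞) ≤
            (randQueryComplexity γ (QueryProblem.comp (choiceRelation n) f) : ℝ≥0∞)) := by
  refine ⟨3 / 4, by norm_num, by norm_num, 1 / 20, by norm_num, fun m X f n γ hγ _ =>
    ⟨fun k _ => mainTheorem7_general (labels_labelThreshold n k) f hγ, fun _ => ?_⟩⟩
  simpa using mainTheorem7_general (labels_choiceRelation n) f hγ
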